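/- **Setting.** For a symmetric bilinear form $(\,,\,)$ on $M$ and a vector $\gamma$ with $(\gamma,\gamma)\neq 0$, write $s_\gamma(x)=x-\frac{2(x,\gamma)}{(\gamma,\gamma)}\gamma$ (in the lattice case below, $\frac{2(x,\gamma)}{(\gamma,\gamma)}$ is an integer for all vectors $\gamma$ that occur). A *generalized Coxeter datum* with $n$ simple roots is given by one of the following: (i) a free abelian group $M$ of finite rank with a non-degenerate, possibly non-symmetric, bilinear form $\langle\,,\,\rangle:M\times M\to\mathbb Z$, the form $(x,y)=\langle x,y\rangle+\langle y,x\rangle$, and a tuple $(\alpha_1,\dots,\alpha_n)$ that generates $M$ as a group and satisfies $\langle\alpha_i,\alpha_i\rangle>0$, $\langle\alpha_i,\alpha_i\rangle\mid\langle\alpha_i,\gamma\rangle$ and $\langle\alpha_i,\alpha_i\rangle\mid\langle\gamma,\alpha_i\rangle$ for all $i$ and all $\gamma\in M$, and $\langle\alpha_i,\alpha_j\rangle=0$ for all $j<i$ (a complete exceptional sequence); (ii) a real vector space $M$ with a symmetric bilinear form $(\,,\,)$ and a tuple $(\alpha_1,\dots,\alpha_n)$ of vectors with $(\alpha_i,\alpha_i)\ne0$.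 Put $s_i=s_{\alpha_i}$, $S=\{s_1,\dots,s_n\}$, $W=\langle s_1,\dots,s_n\rangle\subseteq\mathrm{Aut}(M)$, $\Phi=\{w(\alpha_i)\mid w\in W,\ 1\le i\le n\}$, $T=\{s_\gamma\mid\gamma\in\Phi\}\subseteq W$ and $c=s_1\cdots s_n$. Let $\ell_T(w)$ be the minimal $r$ such that $w$ is a product of $r$ elements of $T$, and let $\mathrm{Red}_T(c)$ be the set of tuples $(t_1,\dots,t_r)\in T^r$ with $r=\ell_T(c)$ and $t_1\cdots t_r=c$. For a group $G$, the braid group $B_r$ with standard generators $\sigma_1,\dots,\sigma_{r-1}$ acts on $G^r$ by the *Hurwitz action* $$\sigma_i(g_1,\dots,g_r)=(g_1,\dots,g_{i-1},\,g_{i+1},\,g_{i+1}^{-1}g_ig_{i+1},\,g_{i+2},\dots,g_r).$$ **Theorem 6.14.** Let $n\ge2$ and let $(W,S)$ be a generalized Coxeter datum with $n$ simple roots such that $\ell_T(c)=n$. Let $(\overline W,\overline S)$ be a Coxeter system with $\overline S=\{\bar s_1,\dots,\bar s_{n-1}\}$ of rank $n-1$ and set of reflections $\overline T=\{w\bar s_iw^{-1}\}$,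 and let $p:W\to\overline W$ be a group epimorphism (applied to tuples entrywise) such that: * (T1) $p(s_i)=\bar s_i$ for $1\le i\le n-1$, and $p(s_n)=\bar s_{n-1}$; * (T2) every $\bar t\in\overline T$ for which some $(t_1,\dots,t_n)\in\mathrm{Red}_T(c)$ satisfies $p(t_1,\dots,t_n)=(\bar s_1,\dots,\bar s_{n-2},\bar t,\bar t)$ is of the form $\bar t=x\bar s_{n-1}x^{-1}$ with $x\in\langle\bar s_1,\dots,\bar s_{n-2}\rangle$; * (T3) every $(t_1,\dots,t_n)\in\mathrm{Red}_T(c)$ with $p(t_1,\dots,t_n)=(\bar s_1,\dots,\bar s_{n-2},\bar s_{n-1},\bar s_{n-1})$ is carried to $(s_1,\dots,s_n)$ by some element of the subgroup $\langle\sigma_{n-1}\rangle\subseteq B_n$ under the Hurwitz action. Then the Hurwitz action of $B_n$ on $\mathrm{Red}_T(c)$ is transitive: for all $t,u\in\mathrm{Red}_T(c)$ there is $b\in B_n$ with $b(t)=u$. -/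

import Mathlib

noncomputable section

/-! ### The braid group and the Hurwitz action -/

/-- The defining relations of the braid group on `r` strands: far commutativity and the braid
relation, for generators indexed by `0, …, r - 2`. -/
inductive IsBraidRelation (r : ℕ) : FreeGroup (Fin (r - 1)) → Prop
  | comm (i j : Fin (r - 1)) (h : i.val + 2 ≤ j.val) :
      IsBraidRelation r (.of i * .of j * (.of j * .of i)⁻¹)
  | braid (i j : Fin (r - 1)) (h : i.val + 1 = j.val) :
      IsBraidRelation r (.of i * .of j * .of i * (.of j * .of i * .of j)⁻¹)

/-- The braid group `B_r` on `r` strands. -/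
abbrev BraidGroup (r : ℕ) : Type := PresentedGroup {x | IsBraidRelation r x}

/-- The standard generator of the braid group; `braidGen i` is `σ_{i+1}` in one-based numbering. -/
def braidGen {r : ℕ} (i : Fin (r - 1)) : BraidGroup r := PresentedGroup.of i

section Hurwitz

variable {G : Type*} [Group G] {r : ℕ}

/-- The Hurwitz move
`(…, g_i, g_{i+1}, …) ↦ (…, g_{i+1}, g_{i+1}⁻¹ g_i g_{i+1}, …)` at the positions `i, i + 1`. -/
def hurwitzMove (i : Fin (r - 1)) : Equiv.Perm (Fin r → G) where
  toFun g k :=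
    if k.val = i.val then g ⟨i.val + 1, by omega⟩
    else if k.val = i.val + 1 then
      (g ⟨i.val + 1, by omega⟩)⁻¹ * g ⟨i.val, by omega⟩ * g ⟨i.val + 1, by omega⟩
    else g k
  invFun g k :=
    if k.val = i.val then
      g ⟨i.val, by omega⟩ * g ⟨i.val + 1, by omega⟩ * (g ⟨i.val, by omega⟩)⁻¹
    else if k.val = i.val + 1 then g ⟨i.val, by omega⟩
    else g k
  left_inv g := by
    funext k
    by_cases h1 : k.val = i.val
    · have : k = ⟨i.val, by omega⟩ := Fin.ext h1
      rw [this]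
      simp [mul_assoc]
    · by_cases h2 : k.val = i.val + 1
      · have : k = ⟨i.val + 1, by omega⟩ := Fin.ext h2
        rw [this]
        simp
      · simp [h1, h2]
  right_inv g := by
    funext k
    by_cases h1 : k.val = i.val
    · have : k = ⟨i.val, by omega⟩ := Fin.ext h1
      rw [this]
      simp
    · by_cases h2 : k.val = i.val + 1
      · have : k = ⟨i.val + 1, by omega⟩ := Fin.ext h2
        rw [this]
        simp [mul_assoc]
      · simp [h1, h2]

theorem hurwitzMove_apply (i : Fin (r - 1)) (g : Fin r → G) (k : Fin r) :
    hurwitzMove i g k =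
      if k.val = i.val then g ⟨i.val + 1, by omega⟩
      else if k.val = i.val + 1 then
        (g ⟨i.val + 1, by omega⟩)⁻¹ * g ⟨i.val, by omega⟩ * g ⟨i.val + 1, by omega⟩
      else g k := rfl

theorem hurwitzMove_comm (i j : Fin (r - 1)) (h : i.val + 2 ≤ j.val) :
    (hurwitzMove i * hurwitzMove j : Equiv.Perm (Fin r → G)) = hurwitzMove j * hurwitzMove i := by
  ext g k
  simp only [Equiv.Perm.mul_apply, hurwitzMove_apply]
  have e1 : ¬ i.val = j.val := by omega
  have e2 : ¬ i.val = j.val + 1 := by omega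
  have e3 : ¬ i.val + 1 = j.val := by omega
  have e4 : ¬ j.val = i.val := by omega
  have e5 : ¬ j.val + 1 = i.val := by omega
  have e6 : ¬ j.val = i.val + 1 := by omega
  have e7 : ¬ j.val + 1 = i.val + 1 := by omega
  have e8 : ¬ i.val + 1 = j.val + 1 := by omega
  simp only [e1, e2, e3, e4, e5, e6, e7, e8, if_false]
  split_ifs <;> first | rfl | omega

theorem hurwitzMove_braid (i j : Fin (r - 1)) (h : i.val + 1 = j.val) :
    (hurwitzMove i * hurwitzMove j * hurwitzMove i : Equiv.Perm (Fin r → G)) =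
      hurwitzMove j * hurwitzMove i * hurwitzMove j := by
  ext g k
  obtain ⟨j, hj⟩ := j
  simp only at h
  subst h
  simp only [Equiv.Perm.mul_apply, hurwitzMove_apply]
  have a1 : ¬ i.val = i.val + 1 := by omega
  have a2 : ¬ i.val + 1 = i.val := by omega
  have a3 : ¬ i.val + 1 + 1 = i.val := by omega
  have a4 : ¬ i.val + 1 + 1 = i.val + 1 := by omega
  have a5 : ¬ i.val = i.val + 1 + 1 := by omega
  have a6 : ¬ i.val + 1 = i.val + 1 + 1 := by omega
  simp only [a1, a2, a3, a4, a5, a6, if_false, if_true]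
  split_ifs <;> first | rfl | omega | group

/-- The Hurwitz action of the braid group `B_r` on `G ^ r`. -/
def hurwitzAction (G : Type*) [Group G] (r : ℕ) : BraidGroup r →* Equiv.Perm (Fin r → G) :=
  PresentedGroup.toGroup (f := hurwitzMove) (by
    rintro _ (⟨i, j, h⟩ | ⟨i, j, h⟩)
    · simp only [map_mul, map_inv, FreeGroup.lift_apply_of]
      rw [hurwitzMove_comm i j h, mul_inv_cancel]
    · simp only [map_mul, map_inv, FreeGroup.lift_apply_of]
      rw [hurwitzMove_braid i j h, mul_inv_cancel])

end Hurwitz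

/-! ### Reflection length and reduced factorizations -/

section Length

variable {G : Type*} [Group G]

/-- The length of `w` with respect to a generating set `T` (generating as a monoid): the minimal
number of factors in an expression of `w` as a product of elements of `T`. -/
def lengthWrt (T : Set G) (w : G) : ℕ :=
  sInf {r | ∃ t : Fin r → G, (∀ i, t i ∈ T) ∧ (List.ofFn t).prod = w}

/-- The tuples `(t_1, …, t_r)` in `T` with `w = t_1 ⋯ t_r` where `r` is the length of `w`
(the set is empty if `r` is not the length of `w`). -/
def Red (T : Set G) (r : ℕ) (w : G) : Set (Fin r → G) :=
  {t | lengthWrt T w = r ∧ (∀ i, t i ∈ T) ∧ (List.ofFn t).prod = w}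

end Length

/-! ### Bilinear lattices and exceptional sequences -/

section Lattice

variable {Γ : Type*} [AddCommGroup Γ]

/-- `α` is a pseudo-root of the bilinear lattice `(Γ, K)`. -/
structure IsPseudoRoot (K : Γ →ₗ[ℤ] Γ →ₗ[ℤ] ℤ) (α : Γ) : Prop where
  pos : 0 < K α α
  dvd_left : ∀ γ, K α α ∣ K α γ
  dvd_right : ∀ γ, K α α ∣ K γ α

/-- `α` is a complete exceptional sequence of the bilinear lattice `(Γ, K)`. -/
structure IsCompleteExceptional (K : Γ →ₗ[ℤ] Γ →ₗ[ℤ] ℤ) {n : ℕ} (α : Fin n → Γ) : Prop where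
  pseudoRoot : ∀ i, IsPseudoRoot K (α i)
  exceptional : ∀ i j, j < i → K (α i) (α j) = 0
  complete : AddSubgroup.closure (Set.range α) = ⊤

end Lattice

/-! ### Generalized Coxeter data -/

/-- The two kinds of data from which a generalized Coxeter datum is built: a bilinear form `B` on
a module and a tuple `α` of vectors, which is either
* the symmetrization of a bilinear lattice `(Γ, K)` with a complete exceptional sequence, or
* a symmetric bilinear form on a real vector space with a tuple of non-isotropic vectors. -/
inductive IsRootDatum.{u} {n : ℕ} : ∀ {R : Type} {M : Type u} [CommRing R] [AddCommGroup M]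
    [Module R M], (M →ₗ[R] M →ₗ[R] R) → (Fin n → M) → Prop
  | lattice {Γ : Type u} [AddCommGroup Γ] [Module.Free ℤ Γ] [Module.Finite ℤ Γ]
      (K : Γ →ₗ[ℤ] Γ →ₗ[ℤ] ℤ) (hK : K.Nondegenerate) (α : Fin n → Γ)
      (hα : IsCompleteExceptional K α) : IsRootDatum (K + K.flip) α
  | vectorSpace {V : Type u} [AddCommGroup V] [Module ℝ V]
      (B : V →ₗ[ℝ] V →ₗ[ℝ] ℝ) (hB : ∀ x y, B x y = B y x) (α : Fin n → V)
      (hα : ∀ i, B (α i) (α i) ≠ 0) : IsRootDatum B α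

/-- The input of a generalized Coxeter datum with `n` simple roots. -/
structure GeneralizedCoxeterDatum (R : Type) (M : Type*) [CommRing R] [AddCommGroup M]
    [Module R M] (n : ℕ) where
  /-- The symmetric bilinear form `B = ( , )`. -/
  form : M →ₗ[R] M →ₗ[R] R
  /-- The simple roots. -/
  root : Fin n → M
  isRootDatum : IsRootDatum form root

namespace GeneralizedCoxeterDatum

variable {R : Type} {M : Type*} [CommRing R] [AddCommGroup M] [Module R M] {n : ℕ}

theorem form_symm (D : GeneralizedCoxeterDatum R M n) (x y : M) : D.form x y = D.form y x := by
  obtain ⟨B, α, h⟩ := D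
  cases h with
  | lattice K hK _ hα => simp [add_comm]
  | vectorSpace _ hB _ hα => exact hB x y

theorem isReflective_root (D : GeneralizedCoxeterDatum R M n) (i : Fin n) :
    D.form.IsReflective (D.root i) := by
  obtain ⟨B, α, h⟩ := D
  cases h with
  | lattice K hK _ hα =>
    have h := hα.pseudoRoot i
    have e : (K + K.flip) (α i) (α i) = 2 * K (α i) (α i) := by simp [two_mul]
    refine ⟨?_, fun y => ?_⟩
    · simp only [e]
      exact .of_ne_zero (by have := h.pos; omega)
    · simp only [e]
      exact mul_dvd_mul_left 2 (by simpa using dvd_add (h.dvd_left y) (h.dvd_right y))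
  | vectorSpace _ hB _ hα => exact ⟨.of_ne_zero (hα i), fun y => (IsUnit.mk0 _ (hα i)).dvd⟩

/-- The reflection `s_γ : x ↦ x - 2 (x, γ) / (γ, γ) • γ`, where `(γ, γ)` is not a zero divisor and
divides every `2 (x, γ)`. -/
def refl (D : GeneralizedCoxeterDatum R M n) {γ : M} (hγ : D.form.IsReflective γ) : M ≃ₗ[R] M :=
  Module.reflection (hγ.coroot_apply_self)

/-- The reflection is given by the usual formula (with the denominator cleared). -/
theorem refl_apply (D : GeneralizedCoxeterDatum R M n) {γ : M} (hγ : D.form.IsReflective γ)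
    (x : M) : D.form γ γ • D.refl hγ x = D.form γ γ • x - (2 * D.form x γ) • γ := by
  rw [refl, Module.reflection_apply, smul_sub, smul_smul,
    LinearMap.IsReflective.apply_self_mul_coroot_apply, D.form_symm γ x]

/-- The reflection group `W` generated by the simple reflections. -/
def W (D : GeneralizedCoxeterDatum R M n) : Subgroup (M ≃ₗ[R] M) :=
  Subgroup.closure (Set.range fun i => D.refl (D.isReflective_root i))

/-- The simple reflections `s_1, …, s_n`, as elements of `W`. -/
def simple (D : GeneralizedCoxeterDatum R M n) (i : Fin n) : D.W :=
  ⟨D.refl (D.isReflective_root i), Subgroup.subset_closure ⟨i, rfl⟩⟩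

/-- The real roots `Φ = {w(α_i)}`. -/
def realRoots (D : GeneralizedCoxeterDatum R M n) : Set M :=
  {γ | ∃ w ∈ D.W, ∃ i, γ = w (D.root i)}

/-- `W` consists of isometries. -/
theorem form_apply_of_mem (D : GeneralizedCoxeterDatum R M n) {w : M ≃ₗ[R] M} (hw : w ∈ D.W) :
    ∀ x y, D.form (w x) (w y) = D.form x y := by
  induction hw using Subgroup.closure_induction with
  | mem w hw =>
    obtain ⟨i, rfl⟩ := hw
    exact LinearMap.IsReflective.isOrthogonal_reflection D.form (D.isReflective_root i)
      ⟨fun x y => D.form_symm x y⟩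
  | one => intro x y; rfl
  | mul u v _ _ hu hv =>
    intro x y
    rw [LinearEquiv.mul_apply, LinearEquiv.mul_apply, hu, hv]
  | inv u _ hu =>
    intro x y
    rw [← hu (u⁻¹ x) (u⁻¹ y), ← LinearEquiv.mul_apply, ← LinearEquiv.mul_apply, mul_inv_cancel]
    rfl

theorem isReflective_of_mem (D : GeneralizedCoxeterDatum R M n) {γ : M} (hγ : γ ∈ D.realRoots) :
    D.form.IsReflective γ := by
  obtain ⟨w, hw, i, rfl⟩ := hγ
  have h := D.isReflective_root i
  refine ⟨?_, fun y => ?_⟩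
  · rw [D.form_apply_of_mem hw]
    exact h.regular
  · obtain ⟨z, rfl⟩ := w.surjective y
    rw [D.form_apply_of_mem hw, D.form_apply_of_mem hw]
    exact h.dvd_two_mul z

/-- The set of reflections `T = {s_γ | γ ∈ Φ}`, as a subset of `W`. -/
def T (D : GeneralizedCoxeterDatum R M n) : Set D.W :=
  {t | ∃ (γ : M) (hγ : γ ∈ D.realRoots), (t : M ≃ₗ[R] M) = D.refl (D.isReflective_of_mem hγ)}

/-- The Coxeter element `c = s_1 ⋯ s_n`. -/
def c (D : GeneralizedCoxeterDatum R M n) : D.W := (List.ofFn D.simple).prod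

end GeneralizedCoxeterDatum

/-- The tuple `(a_1, …, a_m, x, x)`. -/
def appendTwice {G : Type*} {m : ℕ} (a : Fin m → G) (x : G) : Fin (m + 2) → G :=
  Fin.snoc (α := fun _ => G) (Fin.snoc (α := fun _ => G) a x) x

end

/-!
The image under `p` of a reduced factorization of `c` is a factorization of
`p c = s̄_1 ⋯ s̄_{n-2} s̄_{n-1} s̄_{n-1} = s̄_1 ⋯ s̄_{n-2}` into `n` reflections of the Coxeter group.
Hurwitz moves commute with `p`, so it suffices to bring this image by Hurwitz moves to
`(s̄_1, …, s̄_{n-2}, s̄_{n-1}, s̄_{n-1})`: the third hypothesis then connects the lifted factorization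
to `(s_1, …, s_n)`.

The core is a statement on an arbitrary Coxeter system
(`CoxeterSystem.exists_hurwitzEquiv_simple_append_pairs`): every reflection factorization of a
product of distinct simple reflections is Hurwitz equivalent to these simple reflections followed by
pairs `(x, x)`. Consider the partial products of a factorization as a path starting at `1`, and
choose the path in the Hurwitz orbit for which the sum of the lengths is minimal. At a peak
`u < u a > u a b` with `a ≠ b`, moves on the pair `(a, b)` within the dihedral group generated by `a`
and `b` replace `u a` by a shorter element (`CoxeterSystem.exists_hurwitzEquiv_length_lt`).
Otherwise `u` and `u a b` would both have minimal length in the same coset of the dihedral group,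
which is impossible. So either two adjacent entries are equal, and such a pair can be moved to the
right end, or the path ends with an upward step, and the last reflection deletes a letter by strong
exchange; induction on the number of factors concludes. The induction ends with the fact that a
nonempty word without repetitions is nontrivial, which is read off from the geometric representation.
Strong exchange and the dihedral argument both rest on the inversion cocycle
`CoxeterSystem.invCocycle`, which comes from the action of the group on signed elements.

For `n` factors this leaves exactly one pair `(x, x)` after `s̄_1, …, s̄_{n-2}`. By the second
hypothesis `x` is conjugate to `s̄_{n-1}` under `⟨s̄_1, …, s̄_{n-2}⟩`, and moving a pair around another
entry conjugates the pair by that entry (`HurwitzEquiv.append_pair_conj`).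
-/

noncomputable section

/-! ### Hurwitz equivalence of lists -/

/-- Conjugating a reflection by a rotation in a dihedral group generated by `a` and `ρ`. -/
theorem mul_zpow_mul_mul_zpow {G : Type*} [Group G] {a ρ : G} (ha : a * a = 1)
    (hρ : a * ρ * a = ρ⁻¹) (n k : ℤ) :
    ρ ^ n * (a * ρ ^ k) * ρ ^ (-n) = a * ρ ^ (k - 2 * n) := by
  have hinv : a⁻¹ = a := inv_eq_of_mul_eq_one_left ha
  have h : ρ ^ n * a = a * ρ ^ (-n) := by
    have : (a * ρ * a⁻¹) ^ n = a * ρ ^ n * a⁻¹ := conj_zpow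
    rw [hinv, hρ, inv_zpow'] at this
    rw [this, ← mul_assoc, ← mul_assoc, ha, one_mul]
  rw [← mul_assoc, h, mul_assoc, mul_assoc, ← zpow_add, ← zpow_add]
  congr 2
  ring

/-- Two lists in a group are Hurwitz equivalent if they are connected by a sequence of moves
`(…, a, b, …) ↦ (…, b, b⁻¹ a b, …)` and their inverses, i.e. if they lie in the same orbit of the
Hurwitz action of the braid group. -/
inductive HurwitzEquiv {G : Type*} [Group G] : List G → List G → Prop
  | move (A : List G) (a b : G) (B : List G) :
      HurwitzEquiv (A ++ a :: b :: B) (A ++ b :: (b⁻¹ * a * b) :: B)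
  | refl (L : List G) : HurwitzEquiv L L
  | symm {L L' : List G} : HurwitzEquiv L L' → HurwitzEquiv L' L
  | trans {L L' L'' : List G} : HurwitzEquiv L L' → HurwitzEquiv L' L'' → HurwitzEquiv L L''

namespace HurwitzEquiv

variable {G : Type*} [Group G] {L L' : List G}

theorem length_eq (h : HurwitzEquiv L L') : L.length = L'.length := by
  induction h with
  | move A a b B => simp
  | refl L => rfl
  | symm _ ih => exact ih.symm
  | trans _ _ ih₁ ih₂ => exact ih₁.trans ih₂

theorem prod_eq (h : HurwitzEquiv L L') : L.prod = L'.prod := by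
  induction h with
  | move A a b B => simp [mul_assoc]
  | refl L => rfl
  | symm _ ih => exact ih.symm
  | trans _ _ ih₁ ih₂ => exact ih₁.trans ih₂

theorem append_left (K : List G) (h : HurwitzEquiv L L') : HurwitzEquiv (K ++ L) (K ++ L') := by
  induction h with
  | move A a b B => simpa using move (K ++ A) a b B
  | refl L => exact .refl _
  | symm _ ih => exact ih.symm
  | trans _ _ ih₁ ih₂ => exact ih₁.trans ih₂

theorem append_right (K : List G) (h : HurwitzEquiv L L') : HurwitzEquiv (L ++ K) (L' ++ K) := by
  induction h with
  | move A a b B => simpa using move A a b (B ++ K)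
  | refl L => exact .refl _
  | symm _ ih => exact ih.symm
  | trans _ _ ih₁ ih₂ => exact ih₁.trans ih₂

/-- Hurwitz equivalence preserves membership of all entries in a conjugation-invariant set. -/
theorem forall_mem_iff {T : Set G} (hT : ∀ g, ∀ t ∈ T, g * t * g⁻¹ ∈ T)
    (h : HurwitzEquiv L L') : (∀ t ∈ L, t ∈ T) ↔ ∀ t ∈ L', t ∈ T := by
  induction h with
  | move A a b B =>
    have key : a ∈ T ↔ b⁻¹ * a * b ∈ T :=
      ⟨fun h => by simpa using hT b⁻¹ a h, fun h => by simpa [mul_assoc] using hT b _ h⟩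
    simp only [List.mem_append, List.mem_cons, or_imp, forall_and, forall_eq, key]
    tauto
  | refl L => rfl
  | symm _ ih => exact ih.symm
  | trans _ _ ih₁ ih₂ => exact ih₁.trans ih₂

/-- A pair with trivial product moves past any entry. -/
theorem pair_comm_cons {t : G} (ht : t * t = 1) (a : G) :
    HurwitzEquiv [t, t, a] [a, t, t] := by
  have h₁ : HurwitzEquiv [a, t, t] [t, t⁻¹ * a * t, t] := move [] a t [t]
  have h₂ : HurwitzEquiv [t, t⁻¹ * a * t, t] [t, t, t⁻¹ * (t⁻¹ * a * t) * t] :=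
    move [t] _ t []
  have e : t⁻¹ * (t⁻¹ * a * t) * t = a := by
    rw [inv_eq_of_mul_eq_one_left ht]
    simp [mul_assoc, ht, ← mul_assoc t t]
  rw [e] at h₂
  exact (h₁.trans h₂).symm

theorem pair_comm {t : G} (ht : t * t = 1) (B : List G) :
    HurwitzEquiv (t :: t :: B) (B ++ [t, t]) := by
  induction B with
  | nil => exact .refl _
  | cons a B ih =>
    have h := (pair_comm_cons ht a).append_right B
    exact h.trans (ih.append_left [a])

/-- Moving a pair to the left past an entry by inverse moves conjugates it. -/
theorem pair_conj (t a : G) :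
    HurwitzEquiv [a, t, t] [a * t * a⁻¹, a * t * a⁻¹, a] := by
  have h₁ : HurwitzEquiv [a * t * a⁻¹, a * t * a⁻¹, a] _ := move [a * t * a⁻¹] (a * t * a⁻¹) a []
  have h₂ : HurwitzEquiv [a * t * a⁻¹, a, t] _ := move [] (a * t * a⁻¹) a [t]
  have e : a⁻¹ * (a * t * a⁻¹) * a = t := by group
  rw [e] at h₁ h₂
  exact (h₁.trans h₂).symm

/-- A pair of equal involutions may be conjugated by any element of the subgroup generated by the
other entries. -/
theorem append_pair_conj {A : List G} {x : G} (hx : x ∈ Subgroup.closure {a | a ∈ A}) {t : G}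
    (ht : t * t = 1) :
    HurwitzEquiv (A ++ [t, t]) (A ++ [x * t * x⁻¹, x * t * x⁻¹]) := by
  induction hx using Subgroup.closure_induction generalizing t with
  | mem a ha =>
    obtain ⟨A₁, A₂, rfl⟩ := List.append_of_mem (show a ∈ A from ha)
    have ht' : (a * t * a⁻¹) * (a * t * a⁻¹) = 1 := by
      rw [conj_mul, ht]; simp
    have h₁ := ((pair_comm ht A₂).symm.append_left (A₁ ++ [a]))
    have h₂ := ((pair_conj t a).append_left A₁).append_right A₂
    have h₃ := (pair_comm ht' (a :: A₂)).append_left A₁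
    simp only [List.append_assoc, List.cons_append, List.nil_append] at h₁ h₂ h₃ ⊢
    exact h₁.trans (h₂.trans h₃)
  | one => simpa using HurwitzEquiv.refl _
  | mul x y _ _ hx hy =>
    have ht' : (y * t * y⁻¹) * (y * t * y⁻¹) = 1 := by
      rw [conj_mul, ht]; simp
    have e : x * y * t * (x * y)⁻¹ = x * (y * t * y⁻¹) * x⁻¹ := by group
    rw [e]
    exact (hy ht).trans (hx ht')
  | inv x _ hx =>
    have ht' : (x⁻¹ * t * x⁻¹⁻¹) * (x⁻¹ * t * x⁻¹⁻¹) = 1 := by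
      rw [conj_mul, ht]; simp
    have h := (hx ht').symm
    have e : x * (x⁻¹ * t * x⁻¹⁻¹) * x⁻¹ = t := by group
    rwa [e] at h

/-- Hurwitz equivalences lift along group homomorphisms. -/
theorem lift {H : Type*} [Group H] (p : G →* H) {N N' : List H} (h : HurwitzEquiv N N')
    {L : List G} (hL : L.map p = N) : ∃ L', HurwitzEquiv L L' ∧ L'.map p = N' := by
  suffices h' : (∀ L : List G, L.map p = N → ∃ L', HurwitzEquiv L L' ∧ L'.map p = N') ∧
      (∀ L : List G, L.map p = N' → ∃ L', HurwitzEquiv L L' ∧ L'.map p = N) from h'.1 L hL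
  clear hL L
  induction h with
  | move A a b B =>
    constructor
    · intro L hL
      simp only [List.map_eq_append_iff, List.map_eq_cons_iff] at hL
      obtain ⟨A, _, rfl, rfl, a, _, rfl, rfl, b, B, rfl, rfl, rfl⟩ := hL
      exact ⟨_, move A a b B, by simp⟩
    · intro L hL
      simp only [List.map_eq_append_iff, List.map_eq_cons_iff] at hL
      obtain ⟨A, _, rfl, rfl, b', _, rfl, rfl, c, B, rfl, hc, rfl⟩ := hL
      refine ⟨A ++ (b' * c * b'⁻¹) :: b' :: B, ?_, by simp [hc, mul_assoc]⟩
      have h := move A (b' * c * b'⁻¹) b' B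
      have e : b'⁻¹ * (b' * c * b'⁻¹) * b' = c := by group
      rw [e] at h
      exact h.symm
  | refl L => exact ⟨fun L hL => ⟨L, .refl _, hL⟩, fun L hL => ⟨L, .refl _, hL⟩⟩
  | symm _ ih => exact ih.symm
  | trans _ _ ih₁ ih₂ =>
    constructor
    · intro L hL
      obtain ⟨L₁, h₁, e₁⟩ := ih₁.1 L hL
      obtain ⟨L₂, h₂, e₂⟩ := ih₂.1 L₁ e₁
      exact ⟨L₂, h₁.trans h₂, e₂⟩
    · intro L hL
      obtain ⟨L₁, h₁, e₁⟩ := ih₂.2 L hL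
      obtain ⟨L₂, h₂, e₂⟩ := ih₁.2 L₁ e₁
      exact ⟨L₂, h₁.trans h₂, e₂⟩

/-- The conjugate of `g` by the product of the other entries moves to the front, where it
becomes `g`. -/
theorem append_conj (B : List G) (g : G) :
    HurwitzEquiv (B ++ [B.prod⁻¹ * g * B.prod]) (g :: B) := by
  induction B generalizing g with
  | nil => simpa using HurwitzEquiv.refl _
  | cons b B ih =>
    have h := (ih (b⁻¹ * g * b)).append_left [b]
    have e : (b :: B).prod⁻¹ * g * (b :: B).prod = B.prod⁻¹ * (b⁻¹ * g * b) * B.prod := by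
      simp [mul_assoc]
    rw [e]
    exact h.trans (move [] g b B).symm

theorem flatMap_pair_append {P : List G}
    (hP : ∀ x ∈ P, x * x = 1) (B : List G) :
    HurwitzEquiv (P.flatMap (fun x => [x, x]) ++ B) (B ++ P.flatMap fun x => [x, x]) := by
  induction P with
  | nil => simpa using HurwitzEquiv.refl _
  | cons x P ih =>
    have h₁ := (ih fun y hy => hP y (by simp [hy])).append_left [x, x]
    have h₂ := (pair_comm (hP x (by simp)) B).append_right
      (P.flatMap fun x => [x, x])
    simp only [List.flatMap_cons, List.append_assoc, List.cons_append, List.nil_append] at h₁ h₂ ⊢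
    exact h₁.trans h₂

/-- The Hurwitz orbit of a pair of involutions `a, b` with product `ρ` consists of all pairs of
reflections with product `ρ` in the dihedral group generated by `a` and `b`; this is the inclusion
needed here. -/
theorem pair_zpow {a ρ : G} (ha : a * a = 1) (hρ : a * ρ * a = ρ⁻¹) (k : ℤ) :
    HurwitzEquiv [a, a * ρ] [a * ρ ^ k, a * ρ ^ (k + 1)] := by
  have hsq : ∀ k : ℤ, (a * ρ ^ k)⁻¹ = a * ρ ^ k := by
    intro k
    have h := mul_zpow_mul_mul_zpow ha hρ k k
    have hinv : a⁻¹ = a := inv_eq_of_mul_eq_one_left ha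
    rw [mul_assoc, mul_assoc, zpow_neg, mul_inv_cancel, mul_one] at h
    rw [mul_inv_rev, hinv, ← zpow_neg]
    have h' := mul_zpow_mul_mul_zpow ha hρ (-k) 0
    simp only [zpow_zero, mul_one, neg_neg] at h'
    rw [← eq_mul_inv_iff_mul_eq, ← zpow_neg, mul_assoc, ← zpow_add] at h'
    rw [h']
    congr 2
    ring
  have step : ∀ k : ℤ, HurwitzEquiv [a * ρ ^ k, a * ρ ^ (k + 1)]
      [a * ρ ^ (k + 1), a * ρ ^ (k + 1 + 1)] := by
    intro k
    have h := move [] (a * ρ ^ k) (a * ρ ^ (k + 1)) []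
    have e : (a * ρ ^ (k + 1))⁻¹ * (a * ρ ^ k) * (a * ρ ^ (k + 1)) = a * ρ ^ (k + 1 + 1) := by
      have e₁ : (a * ρ ^ k) * (a * ρ ^ (k + 1)) = ρ := by
        have h := mul_inv_cancel (a * ρ ^ k)
        rw [hsq] at h
        rw [zpow_add_one, ← mul_assoc a, ← mul_assoc, h, one_mul]
      rw [mul_assoc, e₁, hsq, mul_assoc, ← zpow_add_one]
    rw [e] at h
    exact h
  induction k using Int.induction_on with
  | zero => simpa using HurwitzEquiv.refl _
  | succ k ih => exact ih.trans (step k)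
  | pred k ih =>
    have h := step (-k - 1)
    rw [sub_add_cancel] at h ⊢
    exact ih.trans h.symm

end HurwitzEquiv

/-! ### The braid group orbit of a tuple -/

section

variable {G : Type*} [Group G] {r : ℕ}

theorem hurwitzAction_braidGen (i : Fin (r - 1)) :
    hurwitzAction G r (braidGen i) = hurwitzMove i := by
  simp [hurwitzAction, braidGen]

theorem exists_ofFn_eq {α : Type*} {L : List α} {r : ℕ} (h : L.length = r) :
    ∃ t : Fin r → α, List.ofFn t = L := by
  subst h
  exact ⟨L.get, List.ofFn_get L⟩

theorem ofFn_hurwitzMove {t : Fin r → G} {A B : List G} {a b : G}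
    (ht : List.ofFn t = A ++ a :: b :: B) (hA : A.length < r - 1) :
    List.ofFn (hurwitzMove ⟨A.length, hA⟩ t) = A ++ b :: (b⁻¹ * a * b) :: B := by
  have hlen : r = A.length + (B.length + 1 + 1) := by
    simpa using congrArg List.length ht
  have hval : ∀ (k : ℕ) (hk : k < r), t ⟨k, hk⟩ =
      (A ++ a :: b :: B)[k]'(by simp; omega) := by
    intro k hk
    simp only [← ht, List.getElem_ofFn]
  refine List.ext_getElem (by simp; omega) fun k h₁ h₂ => ?_
  rw [List.length_ofFn] at h₁
  simp only [List.getElem_ofFn, hurwitzMove_apply]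
  rcases lt_trichotomy k A.length with hk | rfl | hk
  · rw [if_neg (by omega), if_neg (by omega), hval]
    simp [hk]
  · rw [if_pos rfl, hval]
    simp
  · rcases Nat.lt_or_ge (A.length + 1) k with hk' | hk'
    · rw [if_neg (by omega), if_neg (by omega), hval]
      obtain ⟨j, rfl⟩ := Nat.exists_eq_add_of_lt hk'
      rw [List.getElem_append_right (by omega), List.getElem_append_right (by omega)]
      have e : A.length + 1 + j + 1 - A.length = j + 1 + 1 := by omega
      simp [e]
    · obtain rfl : k = A.length + 1 := by omega
      rw [if_neg (by omega), if_pos rfl, hval, hval]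
      simp

/-- Hurwitz equivalent tuples lie in the same orbit of the braid group. -/
theorem HurwitzEquiv.exists_hurwitzAction_eq {t u : Fin r → G}
    (h : HurwitzEquiv (List.ofFn t) (List.ofFn u)) :
    ∃ b : BraidGroup r, hurwitzAction G r b t = u := by
  generalize hL : List.ofFn t = L, hL' : List.ofFn u = L' at h
  induction h generalizing t u with
  | move A a b B =>
    have hlen : r = A.length + (B.length + 1 + 1) := by
      simpa using congrArg List.length hL
    have hA : A.length < r - 1 := by omega
    refine ⟨braidGen ⟨A.length, hA⟩, List.ofFn_injective ?_⟩
    rw [hurwitzAction_braidGen, ofFn_hurwitzMove hL, hL']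
  | refl L => exact ⟨1, by simpa using List.ofFn_injective (hL.trans hL'.symm)⟩
  | symm _ ih =>
    obtain ⟨b, rfl⟩ := ih hL' hL
    exact ⟨b⁻¹, by simp⟩
  | @trans L₁ L₂ L₃ h₁ _ ih₁ ih₂ =>
    obtain ⟨v, hv⟩ := exists_ofFn_eq (L := L₂) (r := r) (by
      rw [← h₁.length_eq, ← hL, List.length_ofFn])
    obtain ⟨b₁, rfl⟩ := ih₁ hL hv
    obtain ⟨b₂, rfl⟩ := ih₂ hv hL'
    exact ⟨b₂ * b₁, by simp⟩

end

namespace CoxeterSystem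

variable {B W : Type*} [Group W] {M : CoxeterMatrix B} (cs : CoxeterSystem M W)

/-! ### The inversion cocycle and the strong exchange property -/

section Cocycle

theorem end_mul_apply {α : Type*} (f g : Function.End α) (x : α) : (f * g) x = f (g x) := rfl

theorem end_one_apply {α : Type*} (x : α) : (1 : Function.End α) x = x := rfl

open Classical in
/-- The map `(t, ε) ↦ (s_i t s_i, ε + [t = s_i])`, by which `s_i` acts on signed elements. -/
def signedConj (i : B) : Function.End (W × ZMod 2) :=
  fun x => (cs.simple i * x.1 * cs.simple i, x.2 + if x.1 = cs.simple i then 1 else 0)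

open Classical in
theorem signedConj_mul_pow_apply (i j : B) (m : ℕ) (x : W × ZMod 2) :
    ((cs.signedConj i * cs.signedConj j) ^ m : Function.End (W × ZMod 2)) x =
      ((cs.simple i * cs.simple j) ^ m * x.1 * (cs.simple j * cs.simple i) ^ m,
        x.2 + ∑ k ∈ Finset.range (2 * m),
          if x.1 = (cs.simple j * cs.simple i) ^ k * cs.simple j then 1 else 0) := by
  induction m with
  | zero => simp [end_one_apply]
  | succ m ih =>
    have hinv : ∀ k : ℕ, ((cs.simple i * cs.simple j) ^ k)⁻¹ = (cs.simple j * cs.simple i) ^ k := by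
      intro k; rw [← inv_pow]; simp
    have hcomm : ∀ k : ℕ, cs.simple j * (cs.simple i * cs.simple j) ^ k =
        (cs.simple j * cs.simple i) ^ k * cs.simple j := by
      intro k
      exact (SemiconjBy.pow_right (show SemiconjBy (cs.simple j) (cs.simple i * cs.simple j)
        (cs.simple j * cs.simple i) by simp [SemiconjBy, mul_assoc]) k).eq
    have h₁ : (cs.simple i * cs.simple j) ^ m * x.1 * (cs.simple j * cs.simple i) ^ m =
        cs.simple j ↔ x.1 = (cs.simple j * cs.simple i) ^ (2 * m) * cs.simple j := by
      rw [← hinv m, mul_inv_eq_iff_eq_mul, ← eq_inv_mul_iff_mul_eq, hcomm, hinv, two_mul, pow_add,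
        mul_assoc]
    have h₂ : cs.simple j * ((cs.simple i * cs.simple j) ^ m * x.1 *
        (cs.simple j * cs.simple i) ^ m) * cs.simple j = cs.simple i ↔
        x.1 = (cs.simple j * cs.simple i) ^ (2 * m + 1) * cs.simple j := by
      rw [← hinv m, ← eq_mul_inv_iff_mul_eq, ← eq_inv_mul_iff_mul_eq, mul_inv_eq_iff_eq_mul,
        ← eq_inv_mul_iff_mul_eq, hinv, inv_simple, ← mul_assoc (cs.simple j), mul_assoc _ _ (_ ^ m),
        hcomm, ← mul_assoc, ← mul_assoc, two_mul, add_assoc, pow_add, pow_succ']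
      have hc : ∀ k : ℕ, cs.simple j * cs.simple i * (cs.simple j * cs.simple i) ^ k =
        (cs.simple j * cs.simple i) ^ k * (cs.simple j * cs.simple i) := fun k =>
          (Commute.pow_right (Commute.refl _) k).eq
      simp only [mul_assoc] at hc ⊢
    rw [pow_succ', end_mul_apply, ih, end_mul_apply]
    simp only [signedConj, h₁, h₂]
    rw [show 2 * (m + 1) = 2 * m + 1 + 1 by ring, Finset.sum_range_succ, Finset.sum_range_succ,
      pow_succ' (cs.simple i * cs.simple j) m, pow_succ (cs.simple j * cs.simple i) m]
    simp only [mul_assoc, add_assoc]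

theorem isLiftable_signedConj : M.IsLiftable cs.signedConj := by
  classical
  intro i j
  funext x
  rw [signedConj_mul_pow_apply, two_mul, Finset.sum_range_add]
  -- the `2 m` reflections which occur are `m` reflections, each of them twice
  have e : ∀ k, (cs.simple j * cs.simple i) ^ (M i j + k) = (cs.simple j * cs.simple i) ^ k := by
    intro k; rw [pow_add, simple_mul_simple_pow', one_mul]
  simp only [e, simple_mul_simple_pow, simple_mul_simple_pow', CharTwo.add_self_eq_zero]
  simp [end_one_apply]

/-- The action of the Coxeter group on signed elements. -/
def signedConjHom : W →* Function.End (W × ZMod 2) := cs.lift ⟨_, cs.isLiftable_signedConj⟩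

theorem signedConjHom_simple (i : B) : cs.signedConjHom (cs.simple i) = cs.signedConj i :=
  cs.lift_apply_simple cs.isLiftable_signedConj i

/-- The inversion cocycle: for a reflection `t`, it is `1` if `t` is a right inversion of `w` and
`0` otherwise; see `IsReflection.invCocycle_eq_one_iff`. -/
def invCocycle (w t : W) : ZMod 2 := (cs.signedConjHom w (t, 0)).2

open Classical in
theorem signedConjHom_wordProd (ω : List B) (x : W × ZMod 2) :
    cs.signedConjHom (cs.wordProd ω) x =
      (cs.wordProd ω * x.1 * (cs.wordProd ω)⁻¹, x.2 + ((cs.rightInvSeq ω).count x.1 : ℕ)) := by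
  induction ω with
  | nil => simp [end_one_apply]
  | cons i ω ih =>
    rw [wordProd_cons, map_mul, end_mul_apply, ih,
      signedConjHom_simple, signedConj, rightInvSeq, List.count_cons]
    have h : cs.wordProd ω * x.1 * (cs.wordProd ω)⁻¹ = cs.simple i ↔
        (cs.wordProd ω)⁻¹ * cs.simple i * cs.wordProd ω = x.1 := by
      rw [mul_inv_eq_iff_eq_mul, ← eq_inv_mul_iff_mul_eq, mul_assoc, eq_comm]
    simp only [h, beq_iff_eq]
    split_ifs <;> simp [mul_assoc, add_assoc]

theorem signedConjHom_apply (w : W) (x : W × ZMod 2) :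
    cs.signedConjHom w x = (w * x.1 * w⁻¹, x.2 + cs.invCocycle w x.1) := by
  classical
  obtain ⟨ω, rfl⟩ := cs.wordProd_surjective w
  simp [invCocycle, signedConjHom_wordProd]

theorem invCocycle_mul (u v t : W) :
    cs.invCocycle (u * v) t = cs.invCocycle u (v * t * v⁻¹) + cs.invCocycle v t := by
  rw [invCocycle, map_mul, end_mul_apply, signedConjHom_apply,
    signedConjHom_apply, zero_add, add_comm]

@[simp] theorem invCocycle_one (t : W) : cs.invCocycle 1 t = 0 := by
  simp [invCocycle, end_one_apply]

open Classical in
theorem invCocycle_simple (i : B) (t : W) :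
    cs.invCocycle (cs.simple i) t = if t = cs.simple i then 1 else 0 := by
  simp [invCocycle, signedConjHom_simple, signedConj]

theorem IsReflection.invCocycle_self {cs : CoxeterSystem M W} {t : W} (ht : cs.IsReflection t) :
    cs.invCocycle t t = 1 := by
  classical
  obtain ⟨w, i, rfl⟩ := ht
  have h := cs.invCocycle_mul w w⁻¹ (w * cs.simple i * w⁻¹)
  have e : w⁻¹ * (w * cs.simple i * w⁻¹) * w⁻¹⁻¹ = cs.simple i := by group
  rw [mul_inv_cancel, invCocycle_one, e] at h
  rw [invCocycle_mul, e, invCocycle_mul, invCocycle_simple, if_pos rfl, inv_simple,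
    simple_mul_simple_self, one_mul, add_right_comm, ← h, zero_add]

theorem mem_rightInvSeq_of_invCocycle_eq_one {ω : List B} {t : W}
    (h : cs.invCocycle (cs.wordProd ω) t = 1) : t ∈ cs.rightInvSeq ω := by
  classical
  rw [invCocycle, signedConjHom_wordProd, zero_add] at h
  by_contra hn
  rw [List.count_eq_zero_of_not_mem hn] at h
  simp at h

theorem isRightInversion_of_invCocycle_eq_one {w t : W} (h : cs.invCocycle w t = 1) :
    cs.IsRightInversion w t := by
  obtain ⟨ω, hω, rfl⟩ := cs.exists_isReduced w
  exact cs.isRightInversion_of_mem_rightInvSeq hω (cs.mem_rightInvSeq_of_invCocycle_eq_one h)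

theorem IsReflection.invCocycle_eq_one_iff {cs : CoxeterSystem M W} {t : W}
    (ht : cs.IsReflection t) (w : W) :
    cs.invCocycle w t = 1 ↔ cs.length (w * t) < cs.length w := by
  refine ⟨fun h => (cs.isRightInversion_of_invCocycle_eq_one h).2, fun h => ?_⟩
  by_contra h₁
  have h₀ : cs.invCocycle w t = 0 := by
    generalize cs.invCocycle w t = a at h₁
    decide +revert
  have h₂ : cs.invCocycle (w * t) t = 1 := by
    rw [invCocycle_mul, ht.invCocycle_self, mul_inv_cancel_right, h₀, zero_add]
  have h₃ := (cs.isRightInversion_of_invCocycle_eq_one h₂).2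
  rw [mul_assoc, ht.mul_self, mul_one] at h₃
  omega

theorem IsReflection.invCocycle_eq_zero_iff {cs : CoxeterSystem M W} {t : W}
    (ht : cs.IsReflection t) (w : W) :
    cs.invCocycle w t = 0 ↔ cs.length w < cs.length (w * t) := by
  have h₁ := ht.invCocycle_eq_one_iff w
  have h₂ := ht.length_mul_left_ne w
  have h₃ : cs.invCocycle w t = 0 ↔ ¬ cs.invCocycle w t = 1 := by
    generalize cs.invCocycle w t = a
    decide +revert
  rw [h₃, h₁]
  omega

/-- The strong exchange property: `t` arises by deleting the letter `i` from `ω`, which need not be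
reduced. -/
theorem IsReflection.strong_exchange {cs : CoxeterSystem M W} {t : W} (ht : cs.IsReflection t)
    {ω : List B} (h : cs.length (cs.wordProd ω * t) < cs.length (cs.wordProd ω)) :
    ∃ ω₁ i ω₂, ω = ω₁ ++ i :: ω₂ ∧ t = (cs.wordProd ω₂)⁻¹ * cs.simple i * cs.wordProd ω₂ := by
  have hmem := cs.mem_rightInvSeq_of_invCocycle_eq_one ((ht.invCocycle_eq_one_iff _).2 h)
  clear h
  induction ω with
  | nil => simp at hmem
  | cons j ω ih =>
    rw [rightInvSeq, List.mem_cons] at hmem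
    rcases hmem with hmem | hmem
    · exact ⟨[], j, ω, rfl, hmem⟩
    · obtain ⟨ω₁, i, ω₂, rfl, e⟩ := ih hmem
      exact ⟨j :: ω₁, i, ω₂, rfl, e⟩

end Cocycle

/-! ### The geometric representation -/

section Geometric

/-- The simple coroots of the geometric representation on `B →₀ ℝ`, whose simple roots are the
basis vectors: `⟨α_j, α_i^∨⟩ = -2 cos (π / m_ij)`. If `m_ij = ∞`, encoded as `0`, this is `-2`. -/
def simpleCoroot (M : CoxeterMatrix B) (i : B) : Module.Dual ℝ (B →₀ ℝ) :=
  Finsupp.linearCombination ℝ fun j => -2 * Real.cos (Real.pi / M i j)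

theorem simpleCoroot_single (M : CoxeterMatrix B) (i j : B) :
    simpleCoroot M i (Finsupp.single j 1) = -2 * Real.cos (Real.pi / M i j) := by
  simp [simpleCoroot]

theorem simpleCoroot_self (M : CoxeterMatrix B) (i : B) :
    simpleCoroot M i (Finsupp.single i 1) = 2 := by
  simp [simpleCoroot_single]

/-- The simple reflections of the geometric representation. -/
def geometricReflection (M : CoxeterMatrix B) (i : B) : (B →₀ ℝ) ≃ₗ[ℝ] (B →₀ ℝ) :=
  Module.reflection (simpleCoroot_self M i)

theorem isLiftable_geometricReflection (M : CoxeterMatrix B) :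
    M.IsLiftable (geometricReflection M) := by
  intro i j
  rcases Nat.eq_zero_or_pos (M i j) with h₀ | hpos
  · rw [h₀, pow_zero]
  refine LinearEquiv.ext fun v => ?_
  change ((geometricReflection M i * geometricReflection M j) ^ M i j) v = v
  rw [geometricReflection, geometricReflection]
  have hij := simpleCoroot_single M i j
  have hji := simpleCoroot_single M j i
  rw [M.symmetric] at hji
  obtain ⟨m, hm⟩ : ∃ m, m = M i j := ⟨_, rfl⟩
  rw [← hm] at hij hji hpos ⊢
  rcases eq_or_ne m 1 with rfl | hm₁
  · obtain rfl : i = j := by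
      by_contra hne
      exact M.off_diagonal i j hne hm.symm
    rw [pow_one, LinearEquiv.mul_apply, Module.involutive_reflection]
  rcases eq_or_ne m 2 with rfl | hm₂
  · -- here the rotation angle is `π`, whose sine vanishes, so this case is computed directly
    simp only [Nat.cast_ofNat, Real.cos_pi_div_two, mul_zero] at hij hji
    rw [Module.reflection_mul_reflection_pow_apply, hij, hji]
    norm_num
    module
  · -- the product of the reflections rotates by the angle `θ = 2 π / m`
    obtain ⟨θ, hθ⟩ : ∃ θ : ℝ, θ = 2 * Real.pi / m := ⟨_, rfl⟩
    have hmθ : m * θ = 2 * Real.pi := by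
      rw [hθ]; field_simp
    have hm₃ : (3 : ℝ) ≤ m := by exact_mod_cast (by omega : 3 ≤ m)
    have hsin : Real.sin θ ≠ 0 := by
      have hπ := Real.pi_pos
      refine (Real.sin_pos_of_pos_of_lt_pi ?_ ?_).ne'
      · rw [hθ]; positivity
      · rw [hθ, div_lt_iff₀ (by linarith)]
        nlinarith
    have ht : 2 * Real.cos θ = simpleCoroot M i (Finsupp.single j 1) *
        simpleCoroot M j (Finsupp.single i 1) - 2 := by
      rw [hij, hji, hθ, show 2 * Real.pi / (m : ℝ) = 2 * (Real.pi / m) by ring, Real.cos_two_mul]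
      ring
    have hS := Polynomial.Chebyshev.S_two_mul_real_cos θ
    rw [Module.reflection_mul_reflection_pow_apply _ _ m v _ ht]
    rcases Nat.even_or_odd' m with ⟨k, hk | hk⟩
    · have e₁ : ((m : ℤ) - 2) / 2 = k - 1 := by omega
      have e₂ : ((m : ℤ) - 1) / 2 = k - 1 := by omega
      have h₁ : (Polynomial.Chebyshev.S ℝ (k - 1)).eval (2 * Real.cos θ) = 0 := by
        have := hS (k - 1)
        have hkθ : (k : ℝ) * θ = Real.pi := by
          rw [hk] at hmθ; push_cast at hmθ; linarith
        push_cast at this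
        rw [sub_add_cancel, hkθ, Real.sin_pi] at this
        exact (mul_eq_zero.1 this).resolve_right hsin
      rw [e₁, e₂, h₁]
      simp
    · have e₁ : ((m : ℤ) - 2) / 2 = k - 1 := by omega
      have e₂ : ((m : ℤ) - 1) / 2 = k := by omega
      have e₃ : ((m : ℤ) - 3) / 2 = k - 1 := by omega
      have e₄ : (m : ℤ) / 2 = k := by omega
      have h₁ : (Polynomial.Chebyshev.S ℝ k).eval (2 * Real.cos θ) +
          (Polynomial.Chebyshev.S ℝ (k - 1)).eval (2 * Real.cos θ) = 0 := by
        have h := hS k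
        have h' := hS (k - 1)
        have hkθ : ((k : ℝ) + 1) * θ = 2 * Real.pi - k * θ := by
          rw [hk] at hmθ; push_cast at hmθ; linarith
        push_cast at h h'
        rw [hkθ, Real.sin_two_pi_sub] at h
        rw [sub_add_cancel] at h'
        refine (mul_eq_zero.1 ?_).resolve_right hsin
        rw [add_mul, h, h', neg_add_cancel]
      rw [e₁, e₂, e₃, e₄, h₁]
      simp

/-- A nonempty word without repetitions represents a nontrivial element. -/
theorem eq_nil_of_nodup_of_wordProd_eq_one {ω : List B} (hω : ω.Nodup)
    (h : cs.wordProd ω = 1) : ω = [] := by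
  cases ω with
  | nil => rfl
  | cons i ω =>
    exfalso
    let ρ : W →* ((B →₀ ℝ) ≃ₗ[ℝ] (B →₀ ℝ)) := cs.lift ⟨_, isLiftable_geometricReflection M⟩
    have hρ : ∀ j, ρ (cs.simple j) = geometricReflection M j :=
      fun j => cs.lift_apply_simple (isLiftable_geometricReflection M) j
    -- generators other than `s_i` preserve the `i`-th coordinate
    have key : ∀ ω : List B, i ∉ ω → ∀ v, ρ (cs.wordProd ω) v i = v i := by
      intro ω
      induction ω with
      | nil => simp
      | cons j ω ih =>
        intro hi v
        rw [List.mem_cons, not_or] at hi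
        rw [wordProd_cons, map_mul, hρ, LinearEquiv.mul_apply, geometricReflection,
          Module.reflection_apply]
        simp [Ne.symm hi.1, ih hi.2]
    have h₁ := key ω (List.nodup_cons.1 hω).1 (Finsupp.single i 1)
    rw [wordProd_cons] at h
    rw [eq_inv_of_mul_eq_one_right h, inv_simple, hρ, geometricReflection,
      Module.reflection_apply_self] at h₁
    simp at h₁
    norm_num at h₁

end Geometric

/-! ### Reflection factorizations of products of distinct simple reflections -/

section Factorization

/-- The case of `eq_one_of_invCocycle_eq_zero` in which the dihedral group contains a simple
reflection, whose only inversion is itself. -/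
theorem eq_one_of_invCocycle_eq_zero_of_simple {a ρ : W} (hρ : a * ρ * a = ρ⁻¹)
    (hrefl : ∀ k : ℤ, cs.IsReflection (a * ρ ^ k))
    (h : ∀ k : ℤ, cs.invCocycle ρ (a * ρ ^ k) = 0) {k : ℤ} {i : B}
    (hi : a * ρ ^ k = cs.simple i) : ρ = 1 := by
  have ha : a * a = 1 := by simpa using (hrefl 0).mul_self
  -- the next reflection `a ρ ^ (k + 1)` is an inversion of the simple reflection `a ρ ^ k`, so it
  -- is equal to it
  have hinv : cs.invCocycle (a * ρ ^ k) (a * ρ ^ (k + 1)) = 1 := by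
    have e₁ : a * ρ ^ k = a * ρ ^ (k - 1) * ρ := by
      rw [mul_assoc, ← zpow_add_one, sub_add_cancel]
    have e₂ := mul_zpow_mul_mul_zpow ha hρ 1 (k + 1)
    rw [zpow_neg, zpow_one] at e₂
    rw [e₁, invCocycle_mul, h, add_zero, e₂, show k + 1 - 2 * 1 = k - 1 by ring]
    exact (hrefl _).invCocycle_self
  have hlt := ((hrefl _).invCocycle_eq_one_iff _).1 hinv
  rw [hi, length_simple, Nat.lt_one_iff, length_eq_zero_iff, ← hi, zpow_add_one] at hlt
  have hs := (hrefl k).mul_self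
  rwa [← mul_assoc, ← mul_assoc, mul_assoc (a * ρ ^ k), hs, one_mul] at hlt

/-- If no reflection of the dihedral group generated by the involution `a` and the rotation `ρ` is
an inversion of `ρ`, then `ρ = 1`. Conjugating by a simple reflection outside of the dihedral group
keeps the hypothesis, and such conjugations make one of the reflections simple. -/
theorem eq_one_of_invCocycle_eq_zero {a ρ : W} (hρ : a * ρ * a = ρ⁻¹)
    (hrefl : ∀ k : ℤ, cs.IsReflection (a * ρ ^ k))
    (h : ∀ k : ℤ, cs.invCocycle ρ (a * ρ ^ k) = 0) : ρ = 1 := by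
  classical
  obtain ⟨w, i, hw⟩ : cs.IsReflection a := by simpa using hrefl 0
  obtain ⟨ω, rfl⟩ := cs.wordProd_surjective w
  induction ω generalizing a ρ with
  | nil =>
    exact cs.eq_one_of_invCocycle_eq_zero_of_simple hρ hrefl h (k := 0) (i := i) (by simpa using hw)
  | cons j ω ih =>
    by_cases hj : ∃ k : ℤ, a * ρ ^ k = cs.simple j
    · obtain ⟨k, hk⟩ := hj
      exact cs.eq_one_of_invCocycle_eq_zero_of_simple hρ hrefl h hk
    · have ha : a * a = 1 := by simpa using (hrefl 0).mul_self
      have hne : ∀ k : ℤ, a * ρ ^ k ≠ cs.simple j := fun k hk => hj ⟨k, hk⟩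
      have hx : ∀ k : ℤ, (cs.simple j * a * cs.simple j) *
          (cs.simple j * ρ * cs.simple j) ^ k = cs.simple j * (a * ρ ^ k) * cs.simple j := by
        intro k
        have := conj_zpow (i := k) (a := cs.simple j) (b := ρ)
        rw [inv_simple] at this
        rw [this]
        simp [mul_assoc]
      have key : cs.simple j * ρ * cs.simple j = 1 := by
        refine ih (a := cs.simple j * a * cs.simple j) ?_ (fun k => ?_) (fun k => ?_) ?_
        · rw [mul_inv_rev, mul_inv_rev, inv_simple, ← hρ]
          simp [mul_assoc]
        · rw [hx]
          simpa using (hrefl k).conj (cs.simple j)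
        · have e : cs.simple j * (cs.simple j * (a * ρ ^ k) * cs.simple j) * (cs.simple j)⁻¹ =
              a * ρ ^ k := by simp [mul_assoc]
          have e₂ := mul_zpow_mul_mul_zpow ha hρ 1 k
          rw [zpow_one, zpow_neg_one] at e₂
          rw [hx, invCocycle_mul, e, invCocycle_mul, h, e₂, invCocycle_simple, invCocycle_simple,
            if_neg (hne _), if_neg]
          · simp
          · intro hc
            apply hne k
            have := congrArg (fun z => cs.simple j * z * cs.simple j) hc
            simpa [mul_assoc] using this
        · rw [hw, wordProd_cons]
          simp [mul_assoc]
      have := congrArg (fun z => cs.simple j * z * cs.simple j) key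
      simpa [mul_assoc] using this

theorem isReflection_iff_of_hurwitzEquiv {L L' : List W} (h : HurwitzEquiv L L') :
    (∀ t ∈ L, cs.IsReflection t) ↔ ∀ t ∈ L', cs.IsReflection t :=
  h.forall_mem_iff (T := {t | cs.IsReflection t}) fun g _ ht => IsReflection.conj ht g

/-- A peak `u < u a > u a b` with `a ≠ b` can be lowered by Hurwitz moves on the pair `(a, b)`. -/
theorem exists_hurwitzEquiv_length_lt {u a b : W} (ha : cs.IsReflection a)
    (hb : cs.IsReflection b) (hab : a ≠ b) (h₁ : cs.length u < cs.length (u * a))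
    (h₂ : cs.length (u * a * b) < cs.length (u * a)) :
    ∃ a' b', HurwitzEquiv [a, b] [a', b'] ∧ cs.length (u * a') < cs.length (u * a) := by
  by_contra! hmin
  obtain ⟨ρ, hρ_def⟩ : ∃ ρ, ρ = a * b := ⟨_, rfl⟩
  have hbρ : b = a * ρ := by rw [hρ_def, ← mul_assoc, ha.mul_self, one_mul]
  have hρ : a * ρ * a = ρ⁻¹ := by rw [← hbρ, hρ_def, mul_inv_rev, ha.inv, hb.inv]
  have hequiv : ∀ k : ℤ, HurwitzEquiv [a, b] [a * ρ ^ k, a * ρ ^ (k + 1)] := by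
    intro k
    rw [hbρ]
    exact HurwitzEquiv.pair_zpow ha.mul_self hρ k
  have hrefl : ∀ k : ℤ, cs.IsReflection (a * ρ ^ k) := fun k =>
    (cs.isReflection_iff_of_hurwitzEquiv (hequiv k)).1 (by simp [ha, hb]) _ (by simp)
  -- by minimality, no reflection of the dihedral group is an inversion of `u` or of `u ρ`
  have hu : ∀ k : ℤ, cs.invCocycle u (a * ρ ^ k) = 0 := fun k =>
    ((hrefl k).invCocycle_eq_zero_iff u).2 (h₁.trans_le (hmin _ _ (hequiv k)))
  have huρ : ∀ k : ℤ, cs.invCocycle (u * ρ) (a * ρ ^ k) = 0 := by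
    intro k
    rw [(hrefl k).invCocycle_eq_zero_iff]
    have e : u * ρ * (a * ρ ^ k) = u * (a * ρ ^ (k - 1)) := by
      have h' := mul_zpow_mul_mul_zpow ha.mul_self hρ 1 k
      rw [zpow_one, ← eq_mul_inv_iff_mul_eq, zpow_neg, inv_inv, zpow_one, mul_assoc a,
        ← zpow_add_one] at h'
      rw [mul_assoc, h']
      congr 3
      ring
    rw [e]
    rw [mul_assoc, ← hρ_def] at h₂
    exact h₂.trans_le (hmin _ _ (hequiv _))
  have hone : ρ = 1 := by
    refine cs.eq_one_of_invCocycle_eq_zero hρ hrefl fun k => ?_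
    have h := cs.invCocycle_mul u ρ (a * ρ ^ k)
    have e := mul_zpow_mul_mul_zpow ha.mul_self hρ 1 k
    rw [zpow_one, zpow_neg_one] at e
    rw [e, huρ, hu, zero_add] at h
    exact h.symm
  rw [hone, mul_one] at hbρ
  exact hab hbρ.symm

/-- The sum of the lengths of the elements on the path `x, x t₁, x t₁ t₂, …` after `x`. -/
def pathLength (x : W) : List W → ℕ
  | [] => 0
  | t :: L => cs.length (x * t) + pathLength (x * t) L

theorem pathLength_append (x : W) (A L : List W) :
    cs.pathLength x (A ++ L) = cs.pathLength x A + cs.pathLength (x * A.prod) L := by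
  induction A generalizing x with
  | nil => simp [pathLength]
  | cons t A ih => simp [pathLength, ih, mul_assoc, add_assoc]

/-- Up to Hurwitz equivalence, a nonempty reflection factorization contains two equal adjacent
entries, or its last partial product is shorter than the product: on a path of minimal
`pathLength` without such a repetition there is no peak, so it goes up all the way. -/
theorem exists_hurwitzEquiv_pair_or_length_lt {L : List W} (hL : ∀ t ∈ L, cs.IsReflection t)
    (hne : L ≠ []) :
    (∃ A t B, HurwitzEquiv L (A ++ t :: t :: B)) ∨
      ∃ A t, HurwitzEquiv L (A ++ [t]) ∧ cs.length A.prod < cs.length (A.prod * t) := by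
  obtain ⟨L', hLL', hmin⟩ : ∃ L', HurwitzEquiv L L' ∧
      ∀ L'', HurwitzEquiv L L'' → cs.pathLength 1 L' ≤ cs.pathLength 1 L'' := by
    obtain ⟨L', h₁, h₂⟩ := (measure (cs.pathLength 1)).wf.has_min {L' | HurwitzEquiv L L'}
      ⟨L, .refl L⟩
    exact ⟨L', h₁, fun L'' h => not_lt.1 (h₂ L'' h)⟩
  have hL' := (cs.isReflection_iff_of_hurwitzEquiv hLL').1 hL
  by_cases hpair : ∃ A t B, L' = A ++ t :: t :: B
  · obtain ⟨A, t, B, rfl⟩ := hpair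
    exact .inl ⟨A, t, B, hLL'⟩
  right
  have hup : ∀ A t B, L' = A ++ t :: B → cs.length A.prod < cs.length (A.prod * t) := by
    intro A
    induction A using List.reverseRecOn with
    | nil =>
      rintro t B rfl
      have := (hL' t (by simp)).odd_length.pos
      simpa using this
    | append_singleton A a ih =>
      intro t B hB
      have hB' : L' = A ++ a :: t :: B := by simpa using hB
      have ha : cs.IsReflection a := hL' a (by simp [hB'])
      have ht : cs.IsReflection t := hL' t (by simp [hB'])
      have hat : a ≠ t := by
        rintro rfl
        exact hpair ⟨A, a, B, hB'⟩
      rw [List.prod_append, List.prod_singleton]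
      by_contra hle
      obtain ⟨a', t', h, hlt⟩ := cs.exists_hurwitzEquiv_length_lt ha ht hat
        (ih a (t :: B) hB')
        (lt_of_le_of_ne (not_lt.1 hle) (ht.length_mul_left_ne _))
      have hprod : a * t = a' * t' := by simpa using h.prod_eq
      have h' := (h.append_right B).append_left A
      have := hmin _ (hLL'.trans (hB' ▸ h'))
      rw [hB', pathLength_append, pathLength_append] at this
      simp only [List.cons_append, List.nil_append, pathLength, one_mul] at this
      rw [mul_assoc _ a t, mul_assoc _ a' t', hprod] at this
      omega
  have hne' : L' ≠ [] := by
    rintro rfl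
    exact hne (List.length_eq_zero_iff.1 hLL'.length_eq)
  have e := (List.dropLast_append_getLast hne').symm
  exact ⟨L'.dropLast, L'.getLast hne', e ▸ hLL', hup _ _ [] e⟩

/-- Every reflection factorization of a product of distinct simple reflections is Hurwitz equivalent
to the factorization into these simple reflections, followed by pairs of equal reflections. -/
theorem exists_hurwitzEquiv_simple_append_pairs {L : List W} (hL : ∀ t ∈ L, cs.IsReflection t)
    {ω : List B} (hω : ω.Nodup) (h : L.prod = cs.wordProd ω) :
    ∃ P : List W, (∀ x ∈ P, cs.IsReflection x) ∧
      HurwitzEquiv L (ω.map cs.simple ++ P.flatMap fun x => [x, x]) := by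
  induction hn : L.length using Nat.strong_induction_on generalizing L ω with
  | _ n ih =>
  subst hn
  rcases eq_or_ne L [] with rfl | hne
  · obtain rfl := cs.eq_nil_of_nodup_of_wordProd_eq_one hω (by simpa using h.symm)
    exact ⟨[], by simp, .refl _⟩
  rcases cs.exists_hurwitzEquiv_pair_or_length_lt hL hne with ⟨A, t, B, hAB⟩ | ⟨A, t, hA, hlt⟩
  · -- a pair of equal entries is moved to the right end
    have hrefl := (cs.isReflection_iff_of_hurwitzEquiv hAB).1 hL
    have ht : cs.IsReflection t := hrefl t (by simp)
    have hAB' : HurwitzEquiv L ((A ++ B) ++ [t, t]) := by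
      have := (HurwitzEquiv.pair_comm ht.mul_self B).append_left A
      rw [List.append_assoc]
      exact hAB.trans this
    have hprod := hAB'.prod_eq
    rw [List.prod_append (l₁ := A ++ B), List.prod_pair, ht.mul_self, mul_one] at hprod
    have hlen := hAB'.length_eq
    rw [List.length_append (as := A ++ B)] at hlen
    obtain ⟨P, hP, hABP⟩ := ih (A ++ B).length (by rw [hlen]; simp)
      (fun x hx => hrefl x (by simp at hx ⊢; tauto)) hω (hprod.symm.trans h) rfl
    refine ⟨P ++ [t], ?_, ?_⟩
    · intro x hx
      rcases List.mem_append.1 hx with hx | hx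
      · exact hP x hx
      · rwa [List.mem_singleton.1 hx]
    · have := hAB'.trans (hABP.append_right [t, t])
      simpa using this
  · -- the last entry is removed by strong exchange
    have hrefl := (cs.isReflection_iff_of_hurwitzEquiv hA).1 hL
    have ht : cs.IsReflection t := hrefl t (by simp)
    have hprod : A.prod * t = cs.wordProd ω := by
      rw [← h, hA.prod_eq, List.prod_append, List.prod_singleton]
    have hA' : A.prod = cs.wordProd ω * t := by
      rw [← hprod, mul_assoc, ht.mul_self, mul_one]
    rw [hprod, hA'] at hlt
    obtain ⟨ω₁, i, ω₂, rfl, rfl⟩ := ht.strong_exchange hlt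
    have hnodup : (ω₁ ++ ω₂).Nodup := by
      refine hω.sublist ?_
      simp
    have hA'' : A.prod = cs.wordProd (ω₁ ++ ω₂) := by
      rw [hA', wordProd_append, wordProd_append, wordProd_cons]
      simp [mul_assoc]
    have hlen := hA.length_eq
    rw [List.length_append, List.length_singleton] at hlen
    obtain ⟨P, hP, hAP⟩ := ih A.length (by omega) (fun x hx => hrefl x (by simp [hx])) hnodup
      hA'' rfl
    refine ⟨P, hP, hA.trans ?_⟩
    have h₁ := hAP.append_right [(cs.wordProd ω₂)⁻¹ * cs.simple i * cs.wordProd ω₂]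
    have h₂ := (HurwitzEquiv.flatMap_pair_append (fun x hx => (hP x hx).mul_self)
      [(cs.wordProd ω₂)⁻¹ * cs.simple i * cs.wordProd ω₂]).append_left ((ω₁ ++ ω₂).map cs.simple)
    have h₃ := ((HurwitzEquiv.append_conj (ω₂.map cs.simple) (cs.simple i)).append_left
      (ω₁.map cs.simple)).append_right (P.flatMap fun x => [x, x])
    simp only [wordProd, List.map_append, List.map_cons, List.append_assoc, List.cons_append,
      List.nil_append] at h₁ h₂ h₃ ⊢
    exact h₁.trans (h₂.trans h₃)

end Factorization

end CoxeterSystem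

/-! ### Reflections of a generalized Coxeter datum -/

namespace GeneralizedCoxeterDatum

variable {R : Type} {M : Type*} [CommRing R] [AddCommGroup M] [Module R M] {n : ℕ}

theorem refl_map_apply (D : GeneralizedCoxeterDatum R M n) {w : M ≃ₗ[R] M} (hw : w ∈ D.W) {γ : M}
    (hγ : D.form.IsReflective γ) (hwγ : D.form.IsReflective (w γ)) :
    D.refl hwγ = w * D.refl hγ * w⁻¹ := by
  have key : ∀ x, hwγ.coroot D.form (w x) = hγ.coroot D.form x := by
    intro x
    have h₁ := hwγ.apply_self_mul_coroot_apply D.form (y := w x)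
    have h₂ := hγ.apply_self_mul_coroot_apply D.form (y := x)
    rw [D.form_apply_of_mem hw, D.form_apply_of_mem hw, ← h₂] at h₁
    exact hγ.regular.left h₁
  refine LinearEquiv.ext fun y => ?_
  obtain ⟨x, rfl⟩ := w.surjective y
  have e : w⁻¹ (w x) = x := w.symm_apply_apply x
  rw [LinearEquiv.mul_apply, LinearEquiv.mul_apply, e, refl, refl, Module.reflection_apply,
    Module.reflection_apply, key, map_sub, map_smul]

theorem exists_eq_conj_simple_of_mem_T (D : GeneralizedCoxeterDatum R M n) {t : D.W}
    (ht : t ∈ D.T) : ∃ (w : D.W) (i : Fin n), t = w * D.simple i * w⁻¹ := by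
  obtain ⟨_, ⟨w, hw, i, rfl⟩, ht⟩ := ht
  refine ⟨⟨w, hw⟩, i, Subtype.ext ?_⟩
  rw [ht]
  exact D.refl_map_apply hw (D.isReflective_root i) _

theorem conj_mem_T (D : GeneralizedCoxeterDatum R M n) (g : D.W) {t : D.W} (ht : t ∈ D.T) :
    g * t * g⁻¹ ∈ D.T := by
  obtain ⟨γ, hγ, ht⟩ := ht
  have hgγ : (g : M ≃ₗ[R] M) γ ∈ D.realRoots := by
    obtain ⟨w, hw, i, rfl⟩ := hγ
    exact ⟨g * w, mul_mem g.2 hw, i, rfl⟩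
  refine ⟨_, hgγ, ?_⟩
  rw [D.refl_map_apply g.2 (D.isReflective_of_mem hγ)]
  simp [ht]

theorem mem_red_of_hurwitzEquiv (D : GeneralizedCoxeterDatum R M n) {r : ℕ} {w : D.W}
    {t u : Fin r → D.W} (ht : t ∈ Red D.T r w)
    (h : HurwitzEquiv (List.ofFn t) (List.ofFn u)) : u ∈ Red D.T r w := by
  obtain ⟨h₁, h₂, h₃⟩ := ht
  refine ⟨h₁, ?_, h.prod_eq ▸ h₃⟩
  have := (h.forall_mem_iff fun g _ ht => D.conj_mem_T g ht).1 (by simpa [List.forall_mem_ofFn_iff])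
  simpa [List.forall_mem_ofFn_iff] using this

end GeneralizedCoxeterDatum

/-! ### Transitivity -/

theorem ofFn_appendTwice {G : Type*} {m : ℕ} (a : Fin m → G) (x : G) :
    List.ofFn (appendTwice a x) = List.ofFn a ++ [x, x] := by
  rw [appendTwice, List.ofFn_succ', List.ofFn_succ']
  simp

end

theorem theorem6p14 {R : Type} {M : Type*} [CommRing R] [AddCommGroup M] [Module R M] {m : ℕ}
    -- `(W, S)` is a generalized Coxeter datum with `n = m + 2` simple reflections, `ℓ_T(c) = n`
    (D : GeneralizedCoxeterDatum R M (m + 2))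
    (hc : lengthWrt D.T D.c = m + 2)
    -- a Coxeter system of rank `n - 1 = m + 1`
    {W' : Type*} [Group W'] {C : CoxeterMatrix (Fin (m + 1))} (cs : CoxeterSystem C W')
    (p : D.W →* W') (hp : Function.Surjective p)
    (T1 : (∀ i : Fin (m + 1), p (D.simple i.castSucc) = cs.simple i) ∧
      p (D.simple (Fin.last (m + 1))) = cs.simple (Fin.last m))
    (T2 : ∀ t' : W', cs.IsReflection t' →
      (∃ t ∈ Red D.T (m + 2) D.c,
        p ∘ t = appendTwice (fun i : Fin m => cs.simple i.castSucc) t') →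
      ∃ x ∈ Subgroup.closure (Set.range fun i : Fin m => cs.simple i.castSucc),
        t' = x * cs.simple (Fin.last m) * x⁻¹)
    (T3 : ∀ t ∈ Red D.T (m + 2) D.c,
      p ∘ t = appendTwice (fun i : Fin m => cs.simple i.castSucc) (cs.simple (Fin.last m)) →
      ∃ b ∈ Subgroup.zpowers (braidGen (r := m + 2) (Fin.last m)),
        hurwitzAction D.W (m + 2) b t = D.simple) :
    -- the Hurwitz action of `B_n` on `Red_T(c)` is transitive
    ∀ t ∈ Red D.T (m + 2) D.c, ∀ u ∈ Red D.T (m + 2) D.c,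
      ∃ b : BraidGroup (m + 2), hurwitzAction D.W (m + 2) b t = u := by
  have hsimple : ∀ i : Fin (m + 2), ∃ j, p (D.simple i) = cs.simple j := by
    intro i
    induction i using Fin.lastCases with
    | last => exact ⟨_, T1.2⟩
    | cast i => exact ⟨_, T1.1 i⟩
  have hT : ∀ t ∈ D.T, cs.IsReflection (p t) := by
    intro t ht
    obtain ⟨w, i, rfl⟩ := D.exists_eq_conj_simple_of_mem_T ht
    obtain ⟨j, hj⟩ := hsimple i
    exact ⟨p w, j, by rw [map_mul, map_mul, hj, map_inv]⟩
  -- the image of the Coxeter element is the product of the first `m` simple reflections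
  let ω : List (Fin (m + 1)) := List.ofFn fun i : Fin m => i.castSucc
  have hω : ω.Nodup := List.nodup_ofFn.2 (Fin.castSucc_injective m)
  have hωmap : ω.map cs.simple = List.ofFn fun i : Fin m => cs.simple i.castSucc := by
    simp [ω, List.map_ofFn, Function.comp_def]
  have hpc : p D.c = cs.wordProd ω := by
    have e : (List.ofFn D.simple).map p =
        ω.map cs.simple ++ [cs.simple (Fin.last m), cs.simple (Fin.last m)] := by
      rw [List.map_ofFn, List.ofFn_succ', List.ofFn_succ', hωmap]
      simp [T1.1, T1.2]
    rw [GeneralizedCoxeterDatum.c, map_list_prod, e, List.prod_append, List.prod_pair,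
      cs.simple_mul_simple_self, mul_one, CoxeterSystem.wordProd]
  -- Hurwitz moves on the images lift to `Red_T(c)`
  have hlift : ∀ t ∈ Red D.T (m + 2) D.c, ∀ x : W',
      HurwitzEquiv ((List.ofFn t).map p) (ω.map cs.simple ++ [x, x]) →
      ∃ u ∈ Red D.T (m + 2) D.c, HurwitzEquiv (List.ofFn t) (List.ofFn u) ∧
        p ∘ u = appendTwice (fun i : Fin m => cs.simple i.castSucc) x := by
    intro t ht x h
    obtain ⟨L, hL, hLx⟩ := h.lift p rfl
    obtain ⟨u, rfl⟩ := exists_ofFn_eq (L := L) (r := m + 2) (by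
      rw [← hL.length_eq, List.length_ofFn])
    refine ⟨u, D.mem_red_of_hurwitzEquiv ht hL, hL, List.ofFn_injective ?_⟩
    rw [ofFn_appendTwice, ← hωmap, ← hLx, List.map_ofFn]
  -- it suffices to connect every reduced factorization to the tuple of simple reflections
  suffices h : ∀ t ∈ Red D.T (m + 2) D.c,
      ∃ b : BraidGroup (m + 2), hurwitzAction D.W (m + 2) b t = D.simple by
    intro t ht u hu
    obtain ⟨b, hb⟩ := h t ht
    obtain ⟨b', hb'⟩ := h u hu
    refine ⟨b'⁻¹ * b, ?_⟩
    rw [map_mul, Equiv.Perm.mul_apply, hb, ← hb', map_inv]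
    exact Equiv.symm_apply_apply _ _
  intro t ht
  obtain ⟨P, hP, htP⟩ := cs.exists_hurwitzEquiv_simple_append_pairs
    (L := (List.ofFn t).map p) (by
      intro y hy
      obtain ⟨s, hs, rfl⟩ := List.mem_map.1 hy
      obtain ⟨i, rfl⟩ := List.mem_ofFn.1 hs
      exact hT _ (ht.2.1 i)) hω (by
      rw [← map_list_prod, ht.2.2, hpc])
  -- both sides have length `m + 2`, so there is exactly one pair
  have hlen : P.length = 1 := by
    have h := htP.length_eq
    simp [ω, List.length_flatMap] at h
    omega
  obtain ⟨y, rfl⟩ := List.length_eq_one_iff.1 hlen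
  have hy := hP y (by simp)
  rw [List.flatMap_singleton] at htP
  obtain ⟨u, hu, -, hpu⟩ := hlift t ht y htP
  obtain ⟨x, hx, hxy⟩ := T2 y hy ⟨u, hu, hpu⟩
  have hrange : (Set.range fun i : Fin m => cs.simple i.castSucc) =
      {a | a ∈ ω.map cs.simple} := by
    rw [hωmap]
    ext a
    simp [List.mem_ofFn]
  rw [hrange] at hx
  -- the last two entries are conjugated from `y` into the last simple reflection
  rw [hxy] at htP
  have htP' := htP.trans (HurwitzEquiv.append_pair_conj hx (cs.simple_mul_simple_self _)).symm
  obtain ⟨v, hv, htv, hpv⟩ := hlift t ht _ htP'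
  obtain ⟨b, -, hb⟩ := T3 v hv hpv
  obtain ⟨b', hb'⟩ := htv.exists_hurwitzAction_eq
  exact ⟨b * b', by rw [map_mul, Equiv.Perm.mul_apply, hb', hb]⟩
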